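/- Let $\Bbbk$ be a field with $\operatorname{char}\Bbbk\neq 2$, let $A=\Bbbk[[t]]$ and $F=\Bbbk((t))$, let $p,q\ge 0$ be integers and $n=p+q$. Let $G=\mathrm{GL}_n(F)$, let $B\subset G$ be the Iwahori subgroup, i.e. the group of those matrices in $\mathrm{GL}_n(A)$ that are upper triangular modulo $t$, and let $$K=\left\{\begin{pmatrix}k_1&0\\0&k_2\end{pmatrix}: k_1\in \mathrm{GL}_p(F),\ k_2\in \mathrm{GL}_q(F)\right\}\subset G .$$ Call $g\in G$ an *affine $(p,q)$-clan matrix* if there are - a permutation $\sigma$ of $[1,n]$ with $\sigma^{-1}(1)<\sigma^{-1}(2)<\dots<\sigma^{-1}(p)$ and $\sigma^{-1}(p+1)<\sigma^{-1}(p+2)<\dots<\sigma^{-1}(n)$, - a set $M\subset[1,n]\times[1,n]$ of pairs $(i,j)$ with $i\ne j$, such that $(i,j)\in M$ implies $(i,k)\notin M$ for all $k\neq j$ and $(\ell,j)\notin M$ for all $\ell\ne i$, and such that $\sigma(i)\le p$ and $\sigma(j)>p$ for every $(i,j)\in M$, - for each $(i,j)\in M$ an integer $a_{ij}$, with $a_{ij}\le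 0$ if $i<j$ and $a_{ij}<0$ if $i>j$, such that $g$ is the sum of the permutation matrix of $\sigma$ (with entry $1$ in the positions $(\sigma(c),c)$ for $c\in[1,n]$, and $0$ elsewhere) and the matrix $L$ whose $(\sigma(j),i)$ entry is $t^{a_{ij}}$ for each $(i,j)\in M$ and whose other entries are $0$. Then the affine $(p,q)$-clan matrices form a complete set of pairwise distinct representatives of the double cosets in $K\backslash G/B$: the map $g\mapsto KgB$ is a bijection from the set of affine $(p,q)$-clan matrices onto $K\backslash G/B$. -/

import Mathlib

open scoped MatrixGroups LaurentSeries PowerSeries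

/-- The subgroup of invertible upper triangular matrices in `GL n 𝕜`. -/
def upperTriangularSubgroup (n : ℕ) (𝕜 : Type*) [Field 𝕜] : Subgroup (GL (Fin n) 𝕜) where
  carrier := {g | (g : Matrix (Fin n) (Fin n) 𝕜).IsUpperTriangular}
  one_mem' := Matrix.blockTriangular_one
  mul_mem' := fun ha hb => Matrix.BlockTriangular.mul ha hb
  inv_mem' := fun {a} ha => by
    rw [Set.mem_ofPred_eq, Matrix.coe_units_inv]
    exact Matrix.blockTriangular_inv_of_blockTriangular ha

/-- The Iwahori subgroup of `GL_n(𝕜((t)))`: the (images of the) matrices in `GL_n(𝕜[[t]])` whose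
reduction modulo `t` is upper triangular. -/
noncomputable def iwahoriSubgroup (n : ℕ) (𝕜 : Type*) [Field 𝕜] : Subgroup (GL (Fin n) 𝕜⸨X⸩) :=
  ((upperTriangularSubgroup n 𝕜).comap
    (Matrix.GeneralLinearGroup.map (PowerSeries.constantCoeff (R := 𝕜)))).map
    (Matrix.GeneralLinearGroup.map (algebraMap 𝕜⟦X⟧ 𝕜⸨X⸩))

/-- The block diagonal embedding `(k₁, k₂) ↦ diag(k₁, k₂)` of matrix monoids; the first `p` indices
of `Fin (p + q)` form the first block and the last `q` indices the second. -/
def blockDiagonalHom (p q : ℕ) (F : Type*) [Field F] :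
    Matrix (Fin p) (Fin p) F × Matrix (Fin q) (Fin q) F →*
      Matrix (Fin (p + q)) (Fin (p + q)) F where
  toFun k := Matrix.reindex finSumFinEquiv finSumFinEquiv (Matrix.fromBlocks k.1 0 0 k.2)
  map_one' := by simp
  map_mul' x y := by
    simp [Matrix.fromBlocks_multiply]

/-- The subgroup `GL_p(F) × GL_q(F)` of block diagonal matrices in `GL_{p+q}(F)`. -/
def blockDiagonalSubgroup (p q : ℕ) (F : Type*) [Field F] : Subgroup (GL (Fin (p + q)) F) :=
  ((Units.map (blockDiagonalHom p q F)).comp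
    (MulEquiv.prodUnits (M := Matrix (Fin p) (Fin p) F)
      (N := Matrix (Fin q) (Fin q) F)).symm.toMonoidHom).range

/-- The combinatorial data of an affine `(p,q)`-clan matrix (all indices start from `0`): a
permutation `σ` (the permutation matrix has its `1`s in the positions `(σ c, c)`), a matching `M`
of columns, and an exponent `a i j` for each `(i, j) ∈ M`. -/
structure IsAffineClanDatum (p q : ℕ) (σ : Equiv.Perm (Fin (p + q)))
    (M : Finset (Fin (p + q) × Fin (p + q))) (a : Fin (p + q) → Fin (p + q) → ℤ) : Prop where
  /-- `σ⁻¹(1) < ⋯ < σ⁻¹(p)` -/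
  strictMonoOn_top : StrictMonoOn σ.symm {r | (r : ℕ) < p}
  /-- `σ⁻¹(p+1) < ⋯ < σ⁻¹(p+q)` -/
  strictMonoOn_bot : StrictMonoOn σ.symm {r | p ≤ (r : ℕ)}
  ne : ∀ i j, (i, j) ∈ M → i ≠ j
  right_unique : ∀ i j k, (i, j) ∈ M → (i, k) ∈ M → k = j
  left_unique : ∀ i j l, (i, j) ∈ M → (l, j) ∈ M → l = i
  /-- the first column of a matched pair has its permutation entry in the top block of rows -/
  top : ∀ i j, (i, j) ∈ M → (σ i : ℕ) < p
  /-- the second column of a matched pair has its permutation entry in the bottom block of rows -/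
  bot : ∀ i j, (i, j) ∈ M → p ≤ (σ j : ℕ)
  exponent_nonpos : ∀ i j, (i, j) ∈ M → i < j → a i j ≤ 0
  exponent_neg : ∀ i j, (i, j) ∈ M → j < i → a i j < 0

/-- The sum of the permutation matrix of `σ` and the matrix whose `(σ j, i)` entry is `t ^ (a i j)`
for each `(i, j) ∈ M`, all its other entries being `0`. -/
noncomputable def affineClanSum {p q : ℕ} (𝕜 : Type*) [Field 𝕜] (σ : Equiv.Perm (Fin (p + q)))
    (M : Finset (Fin (p + q) × Fin (p + q))) (a : Fin (p + q) → Fin (p + q) → ℤ) :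
    Matrix (Fin (p + q)) (Fin (p + q)) 𝕜⸨X⸩ :=
  Matrix.of (fun r c => if r = σ c then 1 else 0) +
    Matrix.of (fun r c =>
      if (c, σ.symm r) ∈ M then HahnSeries.single (a c (σ.symm r)) (1 : 𝕜) else 0)

/-- Affine `(p,q)`-clan matrices. -/
def IsAffineClanMatrix (p q : ℕ) {𝕜 : Type*} [Field 𝕜] (g : GL (Fin (p + q)) 𝕜⸨X⸩) : Prop :=
  ∃ (σ : Equiv.Perm (Fin (p + q))) (M : Finset (Fin (p + q) × Fin (p + q)))
    (a : Fin (p + q) → Fin (p + q) → ℤ),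
    IsAffineClanDatum p q σ M a ∧
      (g : Matrix (Fin (p + q)) (Fin (p + q)) 𝕜⸨X⸩) = affineClanSum 𝕜 σ M a

/-!
Let `e` be the diagonal idempotent with `p` entries `1` followed by `q` entries `0`. The block
diagonal subgroup `K` is its centralizer, so `g ↦ g⁻¹ * e * g` identifies the double cosets of `K`
and the Iwahori subgroup `B` with the idempotents of rank `p` up to conjugation by `B`. Under this
map the clan matrix of `(σ, M, a)` becomes a direct sum `Y` of blocks of size `1`, equal to `0` or
`1`, and of blocks `e i ↦ e i - t ^ (a i j) • e j`, `e j ↦ 0` of size `2`, one for each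
`(i, j) ∈ M`; the sign conditions on `a` say that the entries `t ^ (a i j)` do not lie in the
Iwahori order. Conversely the diagonal of `Y` determines the shuffle `σ`, and the clan matrix is the
permutation matrix of `σ` times a unipotent matrix that depends only on `Y`. So it has to be shown
that every idempotent is conjugate under `B` to exactly one such `Y` (`IsNormalIdempotent`).

The arguments rest on the filtration by levels `n * a + c - r`, where `a` is the order of an entry
in row `r` and column `c` (`LevelGE`): the Iwahori order is the part of level at least `0`, and two
positions in the same row never carry the same level.

Uniqueness (`IsNormalIdempotent.eq_of_conj`): from `Y * b = b * Y'` with `b ∈ B`, a comparison of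
leading terms shows that every off-diagonal entry of `Y'` has in its row an off-diagonal entry of
`Y` of at most the same level; by symmetry the two agree.

Existence (`exists_conj_normal`): if an idempotent `E` has level at least `0`, it is conjugate to
its diagonal reduction modulo `t`, as usual for idempotents that are congruent modulo a radical.
Otherwise an entry of minimal level lies off the diagonal, because the leading part of `E` has
square zero; minimality makes the obvious base change that splits off a block of size `2` an element
of `B`, and one proceeds with the complementary indices.
-/

/-! ### The level filtration -/

section Level

variable {𝕜 : Type*} [Field 𝕜] {n : ℕ}

/-- The monomial `t ^ a`, placed in row `r` and column `c` of an `n × n` matrix, has level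
`n * a + c - r`. `LevelGE m r c x` says that the Laurent series `x`, as an entry in that position,
has level at least `m`; this holds for `x = 0`. -/
def LevelGE (m : ℤ) (r c : Fin n) (x : 𝕜⸨X⸩) : Prop :=
  x ≠ 0 → m ≤ n * x.order + c - r

namespace LevelGE

variable {m m' : ℤ} {r s c : Fin n} {x y : 𝕜⸨X⸩}

lemma zero : LevelGE m r c (0 : 𝕜⸨X⸩) := fun h => absurd rfl h

lemma mono (h : LevelGE m r c x) (hm : m' ≤ m) : LevelGE m' r c x :=
  fun hx => hm.trans (h hx)

lemma neg (h : LevelGE m r c x) : LevelGE m r c (-x) := fun hx => by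
  rw [HahnSeries.order_neg]; exact h (neg_ne_zero.1 hx)

lemma add (hx : LevelGE m r c x) (hy : LevelGE m r c y) : LevelGE m r c (x + y) := by
  intro hxy
  rcases eq_or_ne x 0 with rfl | hx0
  · rw [zero_add] at hxy ⊢; exact hy hxy
  rcases eq_or_ne y 0 with rfl | hy0
  · rw [add_zero] at hxy ⊢; exact hx hxy
  have hn : (0 : ℤ) ≤ n := by positivity
  have h1 := hx hx0
  have h2 := hy hy0
  rcases min_le_iff.1 (HahnSeries.min_order_le_order_add hxy) with h | h <;>
    nlinarith [mul_le_mul_of_nonneg_left h hn]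

lemma sub (hx : LevelGE m r c x) (hy : LevelGE m r c y) : LevelGE m r c (x - y) := by
  rw [sub_eq_add_neg]; exact hx.add hy.neg

lemma sum {ι : Type*} {t : Finset ι} {f : ι → 𝕜⸨X⸩} (h : ∀ i ∈ t, LevelGE m r c (f i)) :
    LevelGE m r c (∑ i ∈ t, f i) :=
  Finset.sum_induction _ _ (fun _ _ => add) zero h

lemma mul (hx : LevelGE m r s x) (hy : LevelGE m' s c y) : LevelGE (m + m') r c (x * y) := by
  intro hxy
  rw [HahnSeries.order_mul (left_ne_zero_of_mul hxy) (right_ne_zero_of_mul hxy)]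
  linarith [hx (left_ne_zero_of_mul hxy), hy (right_ne_zero_of_mul hxy)]

lemma single {a : ℤ} (h : m ≤ n * a + c - r) : LevelGE m r c (HahnSeries.single a (1 : 𝕜)) :=
  fun _ => by rwa [HahnSeries.order_single one_ne_zero]

lemma one (hm : m ≤ 0) : LevelGE m r r (1 : 𝕜⸨X⸩) := fun _ => by
  rw [HahnSeries.order_one]; linarith

/-- In the same row, two different positions carry levels that differ modulo `n`. -/
lemma succ_of_row {a : ℤ} (hne : c ≠ s) (h : LevelGE (n * a + s - r) r c x) :
    LevelGE (n * a + s - r + 1) r c x := by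
  intro hx
  refine lt_of_le_of_ne (h hx) fun heq => hne ?_
  have hd : (n : ℤ) ∣ (c : ℤ) - s := ⟨a - x.order, by linarith⟩
  have := Int.eq_zero_of_abs_lt_dvd hd (by rw [abs_lt]; omega)
  ext; omega

lemma one_of_ne (hne : r ≠ c) (h : LevelGE 0 r c x) : LevelGE 1 r c x := by
  simpa using succ_of_row (a := 0) (s := r) (r := r) hne.symm (by simpa using h)

lemma diag_iff (hn : 0 < n) (ha : m = 0 ∨ m = 1) :
    LevelGE m r r x ↔ (x ≠ 0 → m ≤ x.order) := by
  have : (0 : ℤ) < n := by exact_mod_cast hn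
  refine forall_congr' fun _ => ⟨fun h => ?_, fun h => ?_⟩
  · rcases ha with rfl | rfl
    · by_contra! h'; nlinarith
    · by_contra! h'; nlinarith
  · rcases ha with rfl | rfl <;> nlinarith

end LevelGE

/-! ### The Iwahori subgroup -/

lemma order_algebraMap_nonneg (f : 𝕜⟦X⟧) : 0 ≤ (algebraMap 𝕜⟦X⟧ 𝕜⸨X⸩ f).order := by
  rcases eq_or_ne (algebraMap 𝕜⟦X⟧ 𝕜⸨X⸩ f) 0 with h | h
  · rw [h, HahnSeries.order_zero]
  by_contra! hlt
  refine h (HahnSeries.coeff_order_eq_zero.1 ?_)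
  rw [LaurentSeries.coe_algebraMap]
  exact (PowerSeries.coeff_coe _ _).trans (if_pos hlt)

lemma coeff_zero_algebraMap (f : 𝕜⟦X⟧) :
    (algebraMap 𝕜⟦X⟧ 𝕜⸨X⸩ f).coeff 0 = PowerSeries.constantCoeff f := by
  rw [LaurentSeries.coe_algebraMap]
  simpa using LaurentSeries.coeff_coe_powerSeries f 0

lemma exists_algebraMap_eq {x : 𝕜⸨X⸩} (h : x ≠ 0 → 0 ≤ x.order) :
    ∃ f : 𝕜⟦X⟧, algebraMap 𝕜⟦X⟧ 𝕜⸨X⸩ f = x := by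
  rcases eq_or_ne x 0 with rfl | hx
  · exact ⟨0, map_zero _⟩
  obtain ⟨k, hk⟩ := Int.eq_ofNat_of_zero_le (h hx)
  refine ⟨PowerSeries.X ^ k * x.powerSeriesPart, ?_⟩
  rw [LaurentSeries.coe_algebraMap]
  simpa using LaurentSeries.X_order_mul_powerSeriesPart hk.symm

/-- The Iwahori subgroup consists of units of the order of matrices of level at least `0`: a matrix
in that order lies in the Iwahori subgroup as soon as its diagonal entries have order `0`. -/
theorem exists_mem_iwahoriSubgroup {b : Matrix (Fin n) (Fin n) 𝕜⸨X⸩}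
    (hb : ∀ r c, LevelGE 0 r c (b r c)) (hd : ∀ r, b r r ≠ 0 ∧ (b r r).order = 0) :
    ∃ u ∈ iwahoriSubgroup n 𝕜, (u : Matrix (Fin n) (Fin n) 𝕜⸨X⸩) = b := by
  have hord : ∀ r c, b r c ≠ 0 → (if c < r then 1 else 0) ≤ (b r c).order := by
    intro r c h
    have h1 := hb r c h
    have hn : (0 : ℤ) < n := by exact_mod_cast r.pos
    have h3 : ((c : ℕ) : ℤ) < n := by exact_mod_cast c.2
    split_ifs with hcr
    · have : ((c : ℕ) : ℤ) < (r : ℕ) := by exact_mod_cast hcr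
      by_contra! h'; nlinarith
    · by_contra! h'; nlinarith [Int.natCast_nonneg (r : ℕ)]
  choose f hf using fun r c => exists_algebraMap_eq (x := b r c) fun h =>
    le_trans (by split_ifs <;> norm_num) (hord r c h)
  have hconst : ∀ r c, PowerSeries.constantCoeff (f r c) = (b r c).coeff 0 := fun r c => by
    rw [← hf, coeff_zero_algebraMap]
  have htri : ((Matrix.of f).map (PowerSeries.constantCoeff (R := 𝕜))).IsUpperTriangular := by
    intro r c hcr
    simp only [Matrix.map_apply, Matrix.of_apply, hconst]
    rcases eq_or_ne (b r c) 0 with h | h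
    · rw [h, HahnSeries.coeff_zero]
    · refine HahnSeries.coeff_eq_zero_of_lt_order ?_
      have := hord r c h
      rw [if_pos (by simpa using hcr)] at this
      linarith
  have hdet : IsUnit (Matrix.of f).det := by
    rw [PowerSeries.isUnit_iff_constantCoeff, RingHom.map_det, RingHom.mapMatrix_apply,
      Matrix.det_of_isUpperTriangular htri, isUnit_iff_ne_zero, Finset.prod_ne_zero_iff]
    intro r _
    rw [Matrix.map_apply, Matrix.of_apply, hconst, ← (hd r).2]
    exact mt HahnSeries.coeff_order_eq_zero.1 (hd r).1
  refine ⟨_, Subgroup.mem_map.2 ⟨Matrix.GeneralLinearGroup.mk'' _ hdet, ?_, rfl⟩, ?_⟩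
  · exact htri
  · ext1 r c
    exact hf r c

theorem levelGE_of_mem_iwahoriSubgroup {u : GL (Fin n) 𝕜⸨X⸩} (hu : u ∈ iwahoriSubgroup n 𝕜)
    (r c : Fin n) : LevelGE 0 r c (u r c) := by
  obtain ⟨v, hv, rfl⟩ := hu
  intro h
  have h0 := order_algebraMap_nonneg (v r c)
  change 0 ≤ n * (algebraMap 𝕜⟦X⟧ 𝕜⸨X⸩ (v r c)).order + (c : ℤ) - r
  rcases lt_or_ge c r with hcr | hcr
  · have h1 : (algebraMap 𝕜⟦X⟧ 𝕜⸨X⸩ (v r c)).order ≠ 0 := by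
      intro h2
      refine h (HahnSeries.coeff_order_eq_zero.1 ?_)
      change (algebraMap 𝕜⟦X⟧ 𝕜⸨X⸩ (v r c)).coeff (algebraMap 𝕜⟦X⟧ 𝕜⸨X⸩ (v r c)).order = 0
      rw [h2, coeff_zero_algebraMap]
      exact hv hcr
    have h2 : 1 ≤ (algebraMap 𝕜⟦X⟧ 𝕜⸨X⸩ (v r c)).order := by omega
    have : ((r : ℕ) : ℤ) < n := by exact_mod_cast r.2
    nlinarith
  · have : ((r : ℕ) : ℤ) ≤ (c : ℕ) := by exact_mod_cast hcr
    nlinarith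

theorem diag_of_mem_iwahoriSubgroup {u : GL (Fin n) 𝕜⸨X⸩} (hu : u ∈ iwahoriSubgroup n 𝕜)
    (r : Fin n) : u r r ≠ 0 ∧ (u r r).order = 0 := by
  obtain ⟨v, hv, rfl⟩ := hu
  have htri : ((v : Matrix (Fin n) (Fin n) 𝕜⟦X⟧).map
    (PowerSeries.constantCoeff (R := 𝕜))).IsUpperTriangular := hv
  have hdet : ((v : Matrix (Fin n) (Fin n) 𝕜⟦X⟧).map (PowerSeries.constantCoeff (R := 𝕜))).det
      ≠ 0 := by
    rw [← RingHom.mapMatrix_apply, ← RingHom.map_det]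
    exact (((Matrix.isUnit_iff_isUnit_det _).1 v.isUnit).map _).ne_zero
  rw [Matrix.det_of_isUpperTriangular htri, Finset.prod_ne_zero_iff] at hdet
  have h0 : (algebraMap 𝕜⟦X⟧ 𝕜⸨X⸩ (v r r)).coeff 0 ≠ 0 := by
    rw [coeff_zero_algebraMap]
    exact hdet r (Finset.mem_univ r)
  change algebraMap 𝕜⟦X⟧ 𝕜⸨X⸩ (v r r) ≠ 0 ∧ (algebraMap 𝕜⟦X⟧ 𝕜⸨X⸩ (v r r)).order = 0
  refine ⟨fun h => h0 (by rw [h, HahnSeries.coeff_zero]), ?_⟩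
  exact le_antisymm (HahnSeries.order_le_of_coeff_ne_zero h0) (order_algebraMap_nonneg _)

end Level

/-! ### Normal idempotents and their uniqueness -/

section NormalIdempotent

variable {𝕜 : Type*} [Field 𝕜] {n : ℕ}

/-- The normal form of an idempotent matrix under conjugation by the Iwahori subgroup: the diagonal
entries are `0` or `1`, and the nonzero off-diagonal entries are of the form `-t ^ a`, of negative
level, at most one in each row and column, and map a basis vector with diagonal entry `1` to one
with diagonal entry `0`. These are direct sums of blocks of size `1`, equal to `0` or `1`, and of
blocks of size `2`, in which `e i ↦ e i - t ^ a • e j` and `e j ↦ 0`. -/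
structure IsNormalIdempotent (Y : Matrix (Fin n) (Fin n) 𝕜⸨X⸩) : Prop where
  diag : ∀ i, Y i i = 0 ∨ Y i i = 1
  off : ∀ i j, i ≠ j → Y j i ≠ 0 →
    ∃ a : ℤ, Y j i = -HahnSeries.single a (1 : 𝕜) ∧ (n : ℤ) * a + i - j < 0
  row : ∀ i i' j, i ≠ j → i' ≠ j → Y j i ≠ 0 → Y j i' ≠ 0 → i' = i
  col : ∀ i j j', i ≠ j → i ≠ j' → Y j i ≠ 0 → Y j' i ≠ 0 → j' = j
  source : ∀ i j, i ≠ j → Y j i ≠ 0 → Y i i = 1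
  target : ∀ i j, i ≠ j → Y j i ≠ 0 → Y j j = 0

namespace IsNormalIdempotent

variable {Y Y' : Matrix (Fin n) (Fin n) 𝕜⸨X⸩}

/-- Each row has at most one nonzero entry, the diagonal included. -/
lemma row_unique (h : IsNormalIdempotent Y) {r s s' : Fin n} (hs : Y r s ≠ 0) (hs' : Y r s' ≠ 0) :
    s' = s := by
  by_cases h1 : s = r <;> by_cases h2 : s' = r
  · rw [h1, h2]
  · subst h1; exact absurd (h.target _ _ h2 hs') hs
  · subst h2; exact absurd (h.target _ _ h1 hs) hs'
  · exact h.row _ _ _ h1 h2 hs hs'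

/-- The leading term of the `(r, c)` entry of `b * Y'` is that of `b r r * Y' r c`, when `Y' r c` is
a nonzero off-diagonal entry. In `Y * b` it can only come from an off-diagonal entry of `Y` in the
row `r`, whose level is not larger. -/
lemma exists_entry_le (h : IsNormalIdempotent Y) (h' : IsNormalIdempotent Y')
    {b : GL (Fin n) 𝕜⸨X⸩} (hb : b ∈ iwahoriSubgroup n 𝕜)
    (hYb : Y * (b : Matrix (Fin n) (Fin n) 𝕜⸨X⸩) = b * Y') {r c : Fin n} (hrc : c ≠ r) {a : ℤ}
    (ha : Y' r c = -HahnSeries.single a (1 : 𝕜)) (hneg : (n : ℤ) * a + c - r < 0) :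
    ∃ s a', Y r s = -HahnSeries.single a' (1 : 𝕜) ∧ (n : ℤ) * a' + s ≤ n * a + c := by
  have hlev := levelGE_of_mem_iwahoriSubgroup hb
  have hY'rc : Y' r c ≠ 0 := by rw [ha]; simp
  set l : ℤ := (n : ℤ) * a + c - r with hl
  have hrest : LevelGE (l + 1) r c
      (∑ s ∈ Finset.univ.erase r, (b : Matrix (Fin n) (Fin n) 𝕜⸨X⸩) r s * Y' s c) := by
    refine LevelGE.sum fun s hs => ?_
    by_cases hz : Y' s c = 0
    · rw [hz, mul_zero]; exact LevelGE.zero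
    · have hsr := (Finset.mem_erase.1 hs).1
      have hsc : s = c := by
        by_contra hsc
        exact hsr (h'.col c r s hrc (Ne.symm hsc) hY'rc hz)
      subst hsc
      rw [h'.source _ _ hrc hY'rc, mul_one]
      exact (hlev r s).mono (by omega)
  have hlead : ¬ LevelGE (l + 1) r c ((b : Matrix (Fin n) (Fin n) 𝕜⸨X⸩) r r * Y' r c) := by
    obtain ⟨h0, h1⟩ := diag_of_mem_iwahoriSubgroup hb r
    intro hle
    have := hle (mul_ne_zero h0 hY'rc)
    rw [HahnSeries.order_mul h0 hY'rc, h1, ha, HahnSeries.order_neg,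
      HahnSeries.order_single one_ne_zero, zero_add] at this
    omega
  have htot : ¬ LevelGE (l + 1) r c ((Y * (b : Matrix (Fin n) (Fin n) 𝕜⸨X⸩)) r c) := by
    rw [hYb, Matrix.mul_apply, ← Finset.add_sum_erase _ _ (Finset.mem_univ r)]
    intro hle
    refine hlead ?_
    simpa using hle.sub hrest
  rw [Matrix.mul_apply] at htot
  obtain ⟨s, hs⟩ : ∃ s, ¬ LevelGE (l + 1) r c (Y r s * (b : Matrix (Fin n) (Fin n) 𝕜⸨X⸩) s c) := by
    by_contra! hall
    exact htot (LevelGE.sum fun s _ => hall s)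
  have hYrs : Y r s ≠ 0 := by
    intro hz
    rw [hz, zero_mul] at hs
    exact hs LevelGE.zero
  have hsr : s ≠ r := by
    rintro rfl
    rw [(h.diag s).resolve_left hYrs, one_mul] at hs
    exact hs ((hlev s c).mono (by omega))
  obtain ⟨a', ha', -⟩ := h.off s r hsr hYrs
  refine ⟨s, a', ha', ?_⟩
  by_contra! hlt
  rw [ha'] at hs
  refine hs (LevelGE.mono (((LevelGE.single (m := (n : ℤ) * a' + s - r) le_rfl).neg).mul
    (hlev s c)) (by omega))

lemma off_eq (h : IsNormalIdempotent Y) (h' : IsNormalIdempotent Y')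
    {b : GL (Fin n) 𝕜⸨X⸩} (hb : b ∈ iwahoriSubgroup n 𝕜)
    (hYb : Y * (b : Matrix (Fin n) (Fin n) 𝕜⸨X⸩) = b * Y') {r c : Fin n} (hrc : c ≠ r)
    (hne : Y' r c ≠ 0) : Y r c = Y' r c := by
  have hYb' : Y' * ((b⁻¹ : GL (Fin n) 𝕜⸨X⸩) : Matrix (Fin n) (Fin n) 𝕜⸨X⸩) =
      (b⁻¹ : GL (Fin n) 𝕜⸨X⸩) * Y := by
    rw [Units.mul_inv_eq_iff_eq_mul, mul_assoc, hYb, Units.inv_mul_cancel_left]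
  obtain ⟨a, ha, hneg⟩ := h'.off c r hrc hne
  obtain ⟨s, a', ha', hle⟩ := exists_entry_le h h' hb hYb hrc ha hneg
  have hYrs : Y r s ≠ 0 := by rw [ha']; simp
  have hsr : s ≠ r := by
    rintro rfl
    -- the entry has negative level, whereas a diagonal entry `1` has level `0`
    have h1 := (h.diag s).resolve_left hYrs
    have h2 := congrArg HahnSeries.order (h1.symm.trans ha')
    rw [HahnSeries.order_one, HahnSeries.order_neg, HahnSeries.order_single one_ne_zero] at h2
    subst h2
    omega
  obtain ⟨s', a'', ha'', hle'⟩ := exists_entry_le h' h ((iwahoriSubgroup n 𝕜).inv_mem hb) hYb' hsr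
    ha' (by omega)
  have hs' : s' = c := h'.row_unique hne (by rw [ha'']; simp)
  subst hs'
  have haa : a'' = a := by
    have := congrArg HahnSeries.order (ha''.symm.trans ha)
    simpa [HahnSeries.order_neg, HahnSeries.order_single] using this
  subst haa
  have hd : (n : ℤ) ∣ (s' : ℤ) - s := ⟨a' - a'', by linarith⟩
  have h0 := Int.eq_zero_of_abs_lt_dvd hd (by rw [abs_lt]; omega)
  have hss : s = s' := by ext; omega
  subst hss
  have hn : (n : ℤ) ≠ 0 := by have := s.pos; omega
  have : a' = a'' := mul_left_cancel₀ hn (by linarith)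
  rw [ha', ha, this]

lemma diag_eq_one (h : IsNormalIdempotent Y) (h' : IsNormalIdempotent Y')
    {b : GL (Fin n) 𝕜⸨X⸩} (hb : b ∈ iwahoriSubgroup n 𝕜)
    (hYb : Y * (b : Matrix (Fin n) (Fin n) 𝕜⸨X⸩) = b * Y')
    (hoff : ∀ r c, c ≠ r → Y r c = Y' r c) {r : Fin n} (hr : Y' r r = 1) : Y r r = 1 := by
  by_cases hex : ∃ j, r ≠ j ∧ Y' j r ≠ 0
  · obtain ⟨j, hj, hne⟩ := hex
    exact h.source r j hj (by rwa [hoff j r hj])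
  push Not at hex
  have h1 : ((b : Matrix (Fin n) (Fin n) 𝕜⸨X⸩) * Y') r r = b r r := by
    rw [Matrix.mul_apply, Finset.sum_eq_single r, hr, mul_one]
    · intro s _ hs; rw [hex s hs.symm, mul_zero]
    · simp
  rw [← hYb, Matrix.mul_apply] at h1
  obtain ⟨s, -, hs⟩ := Finset.exists_ne_zero_of_sum_ne_zero
    (h1.trans_ne (diag_of_mem_iwahoriSubgroup hb r).1)
  have hYrs := left_ne_zero_of_mul hs
  have hsr : s = r := by
    by_contra hsr
    rw [hoff r s hsr] at hYrs
    rw [h'.target s r hsr hYrs] at hr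
    exact zero_ne_one hr
  subst hsr
  exact (h.diag s).resolve_left hYrs

/-- Normal idempotents that are conjugate under the Iwahori subgroup are equal. -/
theorem eq_of_conj (h : IsNormalIdempotent Y) (h' : IsNormalIdempotent Y')
    {b : GL (Fin n) 𝕜⸨X⸩} (hb : b ∈ iwahoriSubgroup n 𝕜)
    (hYb : Y * (b : Matrix (Fin n) (Fin n) 𝕜⸨X⸩) = b * Y') : Y = Y' := by
  have hYb' : Y' * ((b⁻¹ : GL (Fin n) 𝕜⸨X⸩) : Matrix (Fin n) (Fin n) 𝕜⸨X⸩) =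
      (b⁻¹ : GL (Fin n) 𝕜⸨X⸩) * Y := by
    rw [Units.mul_inv_eq_iff_eq_mul, mul_assoc, hYb, Units.inv_mul_cancel_left]
  have hb' := (iwahoriSubgroup n 𝕜).inv_mem hb
  have hoff : ∀ r c, c ≠ r → Y r c = Y' r c := by
    intro r c hrc
    by_cases hne : Y' r c = 0
    · by_contra hne'
      have hY : Y r c ≠ 0 := by rwa [hne] at hne'
      exact hne' (off_eq h' h hb' hYb' hrc hY).symm
    · exact off_eq h h' hb hYb hrc hne
  ext1 r c
  rcases eq_or_ne c r with rfl | hrc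
  · rcases h.diag c with h0 | h1
    · rcases h'.diag c with h0' | h1'
      · rw [h0, h0']
      · rw [diag_eq_one h h' hb hYb hoff h1', h1']
    · rw [diag_eq_one h' h hb' hYb' (fun r c hrc => (hoff r c hrc).symm) h1, h1]
  · exact hoff r c hrc

end IsNormalIdempotent

end NormalIdempotent

/-! ### Reduction of idempotents to normal form -/

section Reduction

variable {𝕜 : Type*} [Field 𝕜] {n : ℕ}

/-- `M` vanishes outside the rows and columns in `S`. -/
def SupportedOn (S : Finset (Fin n)) (M : Matrix (Fin n) (Fin n) 𝕜⸨X⸩) : Prop :=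
  ∀ r c, r ∉ S ∨ c ∉ S → M r c = 0

lemma LevelGE.one_apply (r c : Fin n) {m : ℤ} (hm : m ≤ 0) :
    LevelGE m r c ((1 : Matrix (Fin n) (Fin n) 𝕜⸨X⸩) r c) := by
  rcases eq_or_ne r c with rfl | h
  · rw [Matrix.one_apply_eq]; exact LevelGE.one hm
  · rw [Matrix.one_apply_ne h]; exact LevelGE.zero

/-- A diagonal entry of an idempotent of level at least `0` is congruent to `0` or `1` modulo
`t`. -/
lemma levelGE_diag_or {E : Matrix (Fin n) (Fin n) 𝕜⸨X⸩} (hE : E * E = E)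
    (hlev : ∀ r c, LevelGE 0 r c (E r c)) (r : Fin n) :
    LevelGE 1 r r (E r r) ∨ LevelGE 1 r r (E r r - 1) := by
  by_contra! hcon
  obtain ⟨h0, h1⟩ := hcon
  have hprod : LevelGE 1 r r (E r r * (E r r - 1)) := by
    have hsum := congrFun (congrFun hE r) r
    rw [Matrix.mul_apply, ← Finset.add_sum_erase _ _ (Finset.mem_univ r)] at hsum
    have : E r r * (E r r - 1) = -∑ s ∈ Finset.univ.erase r, E r s * E s r := by
      rw [mul_sub, mul_one]; linear_combination hsum
    rw [this]
    refine (LevelGE.sum fun s hs => ?_).neg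
    simpa using ((hlev r s).one_of_ne (Finset.ne_of_mem_erase hs).symm).mul (hlev s r)
  have hsub := (hlev r r).sub (LevelGE.one_apply (𝕜 := 𝕜) r r le_rfl)
  rw [Matrix.one_apply_eq] at hsub
  rw [LevelGE.diag_iff r.pos (by simp)] at h0 h1 hprod hsub
  have hr := (LevelGE.diag_iff r.pos (by simp)).1 (hlev r r)
  push Not at h0 h1
  have := hprod (mul_ne_zero h0.1 h1.1)
  rw [HahnSeries.order_mul h0.1 h1.1] at this
  linarith [h0.2, h1.2, hr h0.1, hsub h1.1]

/-- An idempotent `E` of level at least `0` is congruent to a diagonal idempotent `D` modulo the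
elements of level at least `1`, and then `E * D + (1 - E) * (1 - D)` conjugates `D` to `E`. -/
lemma exists_conj_diagonal {S : Finset (Fin n)} {E : Matrix (Fin n) (Fin n) 𝕜⸨X⸩}
    (hE : E * E = E) (hS : SupportedOn S E) (hlev : ∀ r c, LevelGE 0 r c (E r c)) :
    ∃ b ∈ iwahoriSubgroup n 𝕜, SupportedOn S ((b : Matrix (Fin n) (Fin n) 𝕜⸨X⸩) - 1) ∧
      ∃ Y : Matrix (Fin n) (Fin n) 𝕜⸨X⸩, IsNormalIdempotent Y ∧ SupportedOn S Y ∧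
        E * (b : Matrix (Fin n) (Fin n) 𝕜⸨X⸩) = b * Y := by
  classical
  set d : Fin n → 𝕜⸨X⸩ := fun r => if LevelGE 1 r r (E r r) then 0 else 1 with hd
  set D : Matrix (Fin n) (Fin n) 𝕜⸨X⸩ := Matrix.diagonal d with hD
  have hd01 : ∀ r, d r = 0 ∨ d r = 1 := fun r => by simp only [hd]; split_ifs <;> simp
  have hDD : D * D = D := by
    rw [hD, Matrix.diagonal_mul_diagonal]
    congr 1; ext1 r; rcases hd01 r with h | h <;> rw [h] <;> simp
  have hDS : SupportedOn S D := by
    intro r c h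
    rcases eq_or_ne r c with rfl | hrc
    · have : E r r = 0 := hS r r h
      rw [hD, Matrix.diagonal_apply_eq]
      simp only [hd]
      rw [if_pos (by rw [this]; exact LevelGE.zero)]
    · exact Matrix.diagonal_apply_ne _ hrc
  have hED : ∀ r c, LevelGE 1 r c ((E - D) r c) := by
    intro r c
    rcases eq_or_ne r c with rfl | hrc
    · rw [Matrix.sub_apply, hD, Matrix.diagonal_apply_eq]
      by_cases h : LevelGE 1 r r (E r r)
      · simpa only [hd, if_pos h, sub_zero] using h
      · simpa only [hd, if_neg h] using (levelGE_diag_or hE hlev r).resolve_left h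
    · rw [Matrix.sub_apply, hD, Matrix.diagonal_apply_ne _ hrc, sub_zero]
      exact (hlev r c).one_of_ne hrc
  obtain ⟨U, hU⟩ : ∃ U : Matrix (Fin n) (Fin n) 𝕜⸨X⸩, U = (E - D) * (2 * D - 1) := ⟨_, rfl⟩
  have happ : ∀ r c, U r c = (E - D) r c * (2 * d c - 1) := by
    intro r c
    have : (2 * D - 1 : Matrix (Fin n) (Fin n) 𝕜⸨X⸩) = Matrix.diagonal (fun r => 2 * d r - 1) := by
      rw [← Matrix.diagonal_one, two_mul, hD, Matrix.diagonal_add, Matrix.diagonal_sub]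
      simp [two_mul]
    rw [hU, this, Matrix.mul_diagonal]
  have hlevU : ∀ r c, LevelGE 1 r c (U r c) := by
    intro r c
    rw [happ]
    rcases hd01 c with h | h <;> rw [h]
    · simpa using (hED r c).neg
    · norm_num; exact hED r c
  obtain ⟨b, hb, hbeq⟩ := exists_mem_iwahoriSubgroup (b := 1 + U)
    (fun r c => (LevelGE.one_apply r c le_rfl).add ((hlevU r c).mono zero_le_one))
    (fun r => by
      have h1 := (LevelGE.diag_iff r.pos (by simp)).1 (hlevU r r)
      rw [Matrix.add_apply, Matrix.one_apply_eq]
      set z := U r r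
      have hc : (1 + z).coeff 0 ≠ 0 := by
        rw [HahnSeries.coeff_add, HahnSeries.coeff_one, if_pos rfl]
        rcases eq_or_ne z 0 with hz | hz
        · simp [hz]
        · rw [HahnSeries.coeff_eq_zero_of_lt_order (by linarith [h1 hz])]; simp
      have hne : 1 + z ≠ 0 := fun h => hc (by rw [h, HahnSeries.coeff_zero])
      refine ⟨hne, le_antisymm (HahnSeries.order_le_of_coeff_ne_zero hc) ?_⟩
      rcases eq_or_ne z 0 with hz | hz
      · simp [hz]
      · refine le_trans (le_min ?_ ?_) (HahnSeries.min_order_le_order_add hne)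
        · rw [HahnSeries.order_one]
        · linarith [h1 hz])
  refine ⟨b, hb, ?_, D, ?_, hDS, ?_⟩
  · intro r c h
    rw [hbeq, add_sub_cancel_left, happ, Matrix.sub_apply, hS r c h, hDS r c h, sub_zero, zero_mul]
  · have hoff : ∀ i j, i ≠ j → D j i = 0 := fun i j h => Matrix.diagonal_apply_ne' _ h
    exact ⟨fun i => by simpa [hD] using hd01 i, fun i j h h' => absurd (hoff i j h) h',
      fun i i' j h _ h' => absurd (hoff i j h) h', fun i j j' h _ h' => absurd (hoff i j h) h',
      fun i j h h' => absurd (hoff i j h) h', fun i j h h' => absurd (hoff i j h) h'⟩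
  · have h1 : 1 + U = E * D + (1 - E) * (1 - D) := by
      have : (E - D) * (2 * D - 1) = 2 * (E * D) - E - 2 * (D * D) + D := by noncomm_ring
      rw [hU, this, hDD]; noncomm_ring
    rw [hbeq, h1]
    have h2 : E * (E * D + (1 - E) * (1 - D)) = E * E * D + (E - E * E) * (1 - D) := by noncomm_ring
    have h3 : (E * D + (1 - E) * (1 - D)) * D = E * (D * D) + (1 - E) * (D - D * D) := by
      noncomm_ring
    rw [h2, h3, hE, hDD]; simp

/-- An entry of minimal, negative level of an idempotent is off the diagonal: the leading part of an
idempotent of negative level has square zero. -/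
lemma ne_of_minimal_level {E : Matrix (Fin n) (Fin n) 𝕜⸨X⸩} (hE : E * E = E) {i j : Fin n}
    (hji : E j i ≠ 0) (hneg : (n : ℤ) * (E j i).order + i - j < 0)
    (hmin : ∀ r c, LevelGE ((n : ℤ) * (E j i).order + i - j) r c (E r c)) : i ≠ j := by
  rintro rfl
  set l : ℤ := (n : ℤ) * (E i i).order + i - i with hl
  have hsum := congrFun (congrFun hE i) i
  rw [Matrix.mul_apply, ← Finset.add_sum_erase _ _ (Finset.mem_univ i)] at hsum
  have hsq : LevelGE (2 * l + 1) i i (E i i * E i i) := by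
    rw [eq_sub_of_add_eq hsum]
    refine ((hmin i i).mono (by omega)).sub (LevelGE.sum fun s hs => ?_)
    exact (((hmin i s).succ_of_row (Finset.ne_of_mem_erase hs)).mul (hmin s i)).mono (by omega)
  have := hsq (mul_ne_zero hji hji)
  rw [HahnSeries.order_mul hji hji] at this
  linarith

/-- The block `e i ↦ e i - t ^ a • e j` of size `2`. -/
noncomputable def clanBlock (𝕜 : Type*) [Field 𝕜] (i j : Fin n) (a : ℤ) :
    Matrix (Fin n) (Fin n) 𝕜⸨X⸩ :=
  Matrix.vecMulVec (Pi.single i 1 - HahnSeries.single a (1 : 𝕜) • Pi.single j 1) (Pi.single i 1)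

lemma clanBlock_apply {i j : Fin n} (hij : i ≠ j) (a : ℤ) (r c : Fin n) :
    clanBlock 𝕜 i j a r c =
      if c = i then (if r = i then 1 else if r = j then -HahnSeries.single a 1 else 0) else 0 := by
  rw [clanBlock, Matrix.vecMulVec_apply]
  by_cases hc : c = i
  · by_cases hr : r = i
    · subst hc hr; simp [hij]
    · by_cases hrj : r = j
      · subst hc hrj; simp [hij.symm]
      · subst hc; simp [hr, hrj]
  · simp [hc]

/-- Adding a block on indices outside `S` to a normal idempotent supported on `S`. -/
lemma IsNormalIdempotent.clanBlock_add {S : Finset (Fin n)} {Y : Matrix (Fin n) (Fin n) 𝕜⸨X⸩}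
    (h : IsNormalIdempotent Y) (hS : SupportedOn S Y) {i j : Fin n} (hij : i ≠ j)
    (hi : i ∉ S) (hj : j ∉ S) {a : ℤ} (ha : (n : ℤ) * a + i - j < 0) :
    IsNormalIdempotent (clanBlock 𝕜 i j a + Y) := by
  have hYi : ∀ r c, r = i ∨ c = i ∨ r = j ∨ c = j → Y r c = 0 := by
    rintro r c (rfl | rfl | rfl | rfl)
    exacts [hS _ _ (.inl hi), hS _ _ (.inr hi), hS _ _ (.inl hj), hS _ _ (.inr hj)]
  have hval : ∀ r c, (clanBlock 𝕜 i j a + Y) r c = if c = i then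
      (if r = i then 1 else if r = j then -HahnSeries.single a 1 else 0) else Y r c := by
    intro r c
    rw [Matrix.add_apply, clanBlock_apply hij]
    by_cases hc : c = i
    · rw [if_pos hc, if_pos hc, hYi r c (by simp [hc]), add_zero]
    · rw [if_neg hc, if_neg hc, zero_add]
  have key : ∀ r c, c ≠ r → (clanBlock 𝕜 i j a + Y) r c ≠ 0 →
      (c = i ∧ r = j) ∨
        (c ≠ i ∧ c ≠ j ∧ r ≠ i ∧ r ≠ j ∧ Y r c ≠ 0 ∧ (clanBlock 𝕜 i j a + Y) r c = Y r c) := by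
    intro r c hrc hne
    rw [hval] at hne ⊢
    by_cases hc : c = i
    · subst hc
      rw [if_pos rfl, if_neg hrc.symm] at hne
      exact .inl ⟨rfl, by by_contra hr; simp [hr] at hne⟩
    · rw [if_neg hc] at hne ⊢
      refine .inr ⟨hc, ?_, ?_, ?_, hne, rfl⟩ <;> rintro rfl <;> exact hne (hYi _ _ (by simp))
  refine ⟨fun k => ?_, fun c r hrc hne => ?_, fun c c' r hrc hrc' hne hne' => ?_,
    fun c r r' hrc hrc' hne hne' => ?_, fun c r hrc hne => ?_, fun c r hrc hne => ?_⟩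
  · rw [hval]
    by_cases hk : k = i
    · simp [hk]
    · rw [if_neg hk]; exact h.diag k
  · rcases key r c hrc hne with ⟨rfl, rfl⟩ | ⟨-, -, -, -, hY, heq⟩
    · exact ⟨a, by simp [hval, hrc.symm], ha⟩
    · rw [heq]; exact h.off c r hrc hY
  · rcases key r c hrc hne with ⟨rfl, rfl⟩ | ⟨h1, h2, h3, h4, hY, -⟩ <;>
      rcases key r c' hrc' hne' with ⟨rfl, h5⟩ | ⟨h1', h2', h3', h4', hY', -⟩
    · rfl
    · exact absurd rfl h4'
    · exact absurd h5 h4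
    · exact h.row c c' r hrc hrc' hY hY'
  · rcases key r c hrc hne with ⟨rfl, rfl⟩ | ⟨h1, h2, h3, h4, hY, -⟩ <;>
      rcases key r' c hrc' hne' with ⟨h5, rfl⟩ | ⟨h1', h2', h3', h4', hY', -⟩
    · rfl
    · exact absurd rfl h1'
    · exact absurd h5 h1
    · exact h.col c r r' hrc hrc' hY hY'
  · rcases key r c hrc hne with ⟨rfl, rfl⟩ | ⟨h1, h2, h3, h4, hY, -⟩
    · simp [hval]
    · rw [hval, if_neg h1]; exact h.source c r hrc hY
  · rcases key r c hrc hne with ⟨rfl, rfl⟩ | ⟨h1, h2, h3, h4, hY, -⟩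
    · rw [hval, if_neg hrc.symm]; exact hYi _ _ (by simp)
    · rw [hval, if_neg h3]; exact h.target c r hrc hY

open scoped Matrix

/-- Let `(j, i)` be the position of an entry `y` of minimal level of `E`, which is negative, and let
`a` be the order of `y`. The base change that fixes `e i` and maps
`e j ↦ t ^ (-a) • (e i - E e i)`, `e k ↦ e k - y⁻¹ * E j k • e i` for `k ≠ i, j`,
lies in the Iwahori subgroup because of minimality, and splits off a block of size `2`. -/
lemma exists_conj_clanBlock_add {S : Finset (Fin n)} {E : Matrix (Fin n) (Fin n) 𝕜⸨X⸩}
    (hE : E * E = E) (hS : SupportedOn S E) {i j : Fin n} (hij : i ≠ j) (hji : E j i ≠ 0)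
    (hneg : (n : ℤ) * (E j i).order + i - j < 0)
    (hmin : ∀ r c, LevelGE ((n : ℤ) * (E j i).order + i - j) r c (E r c)) :
    ∃ b ∈ iwahoriSubgroup n 𝕜, SupportedOn S ((b : Matrix (Fin n) (Fin n) 𝕜⸨X⸩) - 1) ∧
      ∃ E' : Matrix (Fin n) (Fin n) 𝕜⸨X⸩, E' * E' = E' ∧ SupportedOn ((S.erase i).erase j) E' ∧
        E * (b : Matrix (Fin n) (Fin n) 𝕜⸨X⸩) = b * (clanBlock 𝕜 i j (E j i).order + E') := by
  have hiS : i ∈ S := by by_contra h; exact hji (hS _ _ (.inr h))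
  have hjS : j ∈ S := by by_contra h; exact hji (hS _ _ (.inl h))
  obtain ⟨y, hy⟩ : ∃ y, y = E j i := ⟨_, rfl⟩
  rw [← hy] at hneg hmin hji ⊢
  obtain ⟨a, ha⟩ : ∃ a, a = y.order := ⟨_, rfl⟩
  rw [← ha] at hneg hmin ⊢
  obtain ⟨T, hT⟩ : ∃ T : 𝕜⸨X⸩, T = HahnSeries.single a 1 := ⟨_, rfl⟩
  obtain ⟨T', hT'⟩ : ∃ T' : 𝕜⸨X⸩, T' = HahnSeries.single (-a) 1 := ⟨_, rfl⟩
  have hTT' : T * T' = 1 := by rw [hT, hT', HahnSeries.single_mul_single]; simp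
  have hT'0 : T' ≠ 0 := right_ne_zero_of_mul_eq_one hTT'
  have hT'ord : T'.order = -a := by rw [hT', HahnSeries.order_single one_ne_zero]
  have hyinv : y⁻¹.order = -a := by
    have := HahnSeries.order_mul hji (inv_ne_zero hji)
    rw [mul_inv_cancel₀ hji, HahnSeries.order_one] at this
    linarith
  -- the images of the basis vectors
  obtain ⟨w, hw⟩ : ∃ w : Fin n → Fin n → 𝕜⸨X⸩, w = fun c =>
      if c = i then Pi.single i 1 else if c = j then T' • (Pi.single i 1 - E.col i) else
        Pi.single c 1 - (y⁻¹ * E j c) • Pi.single i 1 := ⟨_, rfl⟩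
  have hwi : w i = Pi.single i 1 := by rw [hw]; simp
  have hwj : w j = T' • (Pi.single i 1 - E.col i) := by rw [hw]; simp [hij.symm]
  have hwk : ∀ k, k ≠ i → k ≠ j → w k = Pi.single k 1 - (y⁻¹ * E j k) • Pi.single i 1 :=
    fun k h1 h2 => by rw [hw]; simp [h1, h2]
  obtain ⟨B, hB⟩ : ∃ B : Matrix (Fin n) (Fin n) 𝕜⸨X⸩, B = Matrix.of fun r c => w c r := ⟨_, rfl⟩
  have hBapp : ∀ r c, B r c = w c r := fun r c => by rw [hB]; rfl
  have hBcol : ∀ c, B *ᵥ Pi.single c 1 = w c := fun c => by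
    rw [Matrix.mulVec_single_one]; ext1 r; exact hBapp r c
  have hwS : ∀ r c, r ∉ S ∨ c ∉ S → w c r = (1 : Matrix (Fin n) (Fin n) 𝕜⸨X⸩) r c := by
    intro r c h
    rw [Matrix.one_apply]
    by_cases hci : c = i
    · subst hci; rw [hwi, Pi.single_apply]
    by_cases hcj : c = j
    · subst hcj
      have hr : r ∉ S := h.resolve_right (not_not.2 hjS)
      have hri : r ≠ i := fun h' => hr (h' ▸ hiS)
      have hrj : r ≠ c := fun h' => hr (h' ▸ hjS)
      simp [hwj, hri, hrj, hS r i (.inl hr)]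
    · rw [hwk c hci hcj, Pi.sub_apply, Pi.single_apply, Pi.smul_apply, smul_eq_mul, Pi.single_apply]
      rcases h with h | h
      · have hri : r ≠ i := fun h' => h (h' ▸ hiS)
        simp [hri]
      · rw [hS j c (.inr h)]; simp
  have hsingle : ∀ {m : ℤ} (r c : Fin n), m ≤ 0 →
      LevelGE m r c ((Pi.single c 1 : Fin n → 𝕜⸨X⸩) r) := by
    intro m r c hm
    rw [Pi.single_apply, ← Matrix.one_apply]
    exact LevelGE.one_apply r c hm
  have hlevB : ∀ r c, LevelGE 0 r c (B r c) := by
    intro r c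
    rw [hBapp]
    by_cases hci : c = i
    · subst hci
      rw [hwi]
      exact hsingle r c le_rfl
    by_cases hcj : c = j
    · subst hcj
      rw [hwj, Pi.smul_apply, Pi.sub_apply, smul_eq_mul, mul_comm]
      have h1 : LevelGE (-((n : ℤ) * a + i - c)) i c T' := by
        rw [hT']; exact LevelGE.single (by linarith)
      simpa using ((hsingle r i hneg.le).sub (hmin r i)).mul h1
    · rw [hwk c hci hcj, Pi.sub_apply, Pi.smul_apply, smul_eq_mul]
      refine (hsingle r c le_rfl).sub ?_
      by_cases hri : r = i
      · subst hri
        have h1 : LevelGE (-((n : ℤ) * a + r - j)) r j y⁻¹ := fun _ => by rw [hyinv]; linarith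
        simpa using h1.mul (hmin j c)
      · rw [Pi.single_eq_of_ne hri, mul_zero]; exact LevelGE.zero
  have hdiagB : ∀ r, B r r ≠ 0 ∧ (B r r).order = 0 := by
    intro r
    rw [hBapp]
    by_cases hri : r = i
    · subst hri
      rw [hwi, Pi.single_eq_same]; exact ⟨one_ne_zero, HahnSeries.order_one⟩
    by_cases hrj : r = j
    · subst hrj
      have : w r r = T' * -y := by simp [hwj, hij.symm, hy]
      rw [this, HahnSeries.order_mul hT'0 (neg_ne_zero.2 hji), HahnSeries.order_neg, hT'ord, ← ha]
      exact ⟨mul_ne_zero hT'0 (neg_ne_zero.2 hji), by ring⟩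
    · have : w r r = 1 := by simp [hwk r hri hrj, hri]
      rw [this]; exact ⟨one_ne_zero, HahnSeries.order_one⟩
  obtain ⟨b, hb, hbB⟩ := exists_mem_iwahoriSubgroup hlevB hdiagB
  obtain ⟨B', hB'⟩ : ∃ B' : Matrix (Fin n) (Fin n) 𝕜⸨X⸩, B' * B = 1 ∧ B * B' = 1 :=
    ⟨(b⁻¹ : GL (Fin n) 𝕜⸨X⸩), by rw [← hbB]; exact ⟨b.inv_mul, b.mul_inv⟩⟩
  obtain ⟨hB'B, hBB'⟩ := hB'
  have hinj : ∀ {v v' : Fin n → 𝕜⸨X⸩}, B *ᵥ v = B *ᵥ v' → v = v' := fun {v v'} h => by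
    simpa [Matrix.mulVec_mulVec, hB'B] using congrArg (B' *ᵥ ·) h
  obtain ⟨Z, hZ⟩ : ∃ Z, Z = B' * E * B := ⟨_, rfl⟩
  have hBZ : B * Z = E * B := by rw [hZ, ← mul_assoc, ← mul_assoc, hBB', one_mul]
  have hZZ : Z * Z = Z := by
    have : Z * Z = B' * (E * (B * B') * E) * B := by rw [hZ]; noncomm_ring
    rw [this, hBB', mul_one, hE, hZ]
  -- the columns of `Z`
  have hEv : E *ᵥ E.col i = E.col i := by
    rw [← Matrix.mulVec_single_one, Matrix.mulVec_mulVec, hE]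
  have hZcol : ∀ c, B *ᵥ (Z *ᵥ Pi.single c 1) = E *ᵥ w c := fun c => by
    rw [Matrix.mulVec_mulVec, hBZ, ← Matrix.mulVec_mulVec, hBcol]
  have hZi : Z *ᵥ Pi.single i 1 = Pi.single i 1 - T • Pi.single j 1 := by
    apply hinj
    rw [hZcol, hwi, Matrix.mulVec_sub, Matrix.mulVec_smul, hBcol, hBcol, hwi, hwj, smul_smul, hTT',
      one_smul, sub_sub_cancel, Matrix.mulVec_single_one]
  have hZj : Z *ᵥ Pi.single j 1 = 0 := by
    apply hinj
    rw [hZcol, hwj, Matrix.mulVec_smul, Matrix.mulVec_sub, hEv, Matrix.mulVec_single_one, sub_self,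
      smul_zero, Matrix.mulVec_zero]
  have hZk : ∀ k ∉ S, Z *ᵥ Pi.single k 1 = 0 := by
    intro k hk
    have hki : k ≠ i := fun h => hk (h ▸ hiS)
    have hkj : k ≠ j := fun h => hk (h ▸ hjS)
    apply hinj
    rw [hZcol, hwk k hki hkj, hS j k (.inr hk), mul_zero, zero_smul, sub_zero,
      Matrix.mulVec_single_one, Matrix.mulVec_zero]
    ext1 r
    exact hS r k (.inr hk)
  -- the rows of `Z`
  have hEφ : E j ᵥ* E = E j := by
    have := congrFun hE j
    rwa [Matrix.mul_apply_eq_vecMul] at this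
  have hrow : ∀ (v : Fin n → 𝕜⸨X⸩) c, (v ᵥ* B) c = v ⬝ᵥ w c := fun v c => by rw [hB]; rfl
  have hφB : E j ᵥ* B = y • Pi.single i 1 := by
    ext1 c
    rw [hrow, Pi.smul_apply, smul_eq_mul]
    by_cases hci : c = i
    · subst hci; simp [hwi, hy]
    rw [Pi.single_eq_of_ne hci, mul_zero]
    by_cases hcj : c = j
    · subst hcj
      have : E c ⬝ᵥ E.col i = E c i := congrFun (congrFun hE c) i
      rw [hwj, dotProduct_smul, dotProduct_sub, this, dotProduct_single_one, sub_self, smul_zero]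
    · rw [hwk c hci hcj, dotProduct_sub, dotProduct_smul, dotProduct_single_one,
        dotProduct_single_one, ← hy, smul_eq_mul]
      field_simp
      ring
  have hjB : Pi.single j 1 ᵥ* B = -(T' * y) • Pi.single j 1 := by
    ext1 c
    rw [hrow, Pi.smul_apply, smul_eq_mul, single_one_dotProduct]
    by_cases hci : c = i
    · subst hci; simp [hwi, hij]
    by_cases hcj : c = j
    · subst hcj
      simp [hwj, hij.symm, hy]
    · simp [hwk c hci hcj, hcj, hij.symm, Ne.symm hcj]
  have hZri : Pi.single i 1 ᵥ* Z = Pi.single i 1 := by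
    have h1 : E j ᵥ* (B * Z) = E j ᵥ* B := by
      rw [hBZ, ← Matrix.vecMul_vecMul, hEφ]
    rw [← Matrix.vecMul_vecMul, hφB, Matrix.smul_vecMul] at h1
    exact smul_right_injective _ hji h1
  have hZrj : Pi.single j 1 ᵥ* Z = -T • Pi.single i 1 := by
    have h1 : Pi.single j 1 ᵥ* (B * Z) = y • Pi.single i 1 := by
      rw [hBZ, ← Matrix.vecMul_vecMul, ← hφB, Matrix.single_one_vecMul]
      rfl
    rw [← Matrix.vecMul_vecMul, hjB, Matrix.smul_vecMul] at h1
    have h2 : y • Pi.single i (1 : 𝕜⸨X⸩) = -(T' * y) • (-T • Pi.single i (1 : 𝕜⸨X⸩)) := by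
      rw [smul_smul]; congr 1; linear_combination -y * hTT'
    rw [h2] at h1
    exact smul_right_injective _ (neg_ne_zero.2 (mul_ne_zero hT'0 hji)) h1
  have hZrk : ∀ k ∉ S, Pi.single k 1 ᵥ* Z = 0 := by
    intro k hk
    have h1 : Pi.single k 1 ᵥ* (B * Z) = 0 := by
      rw [hBZ, ← Matrix.vecMul_vecMul, Matrix.single_one_vecMul]
      have : E.row k = 0 := funext fun c => hS k c (.inl hk)
      rw [this, Matrix.zero_vecMul]
    have h2 : Pi.single k 1 ᵥ* B = Pi.single k 1 := by
      ext1 c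
      rw [hrow, single_one_dotProduct, hwS k c (.inl hk), Matrix.one_apply, Pi.single_apply]
      simp only [eq_comm]
    rwa [← Matrix.vecMul_vecMul, h2] at h1
  obtain ⟨N, hN⟩ : ∃ N, N = clanBlock 𝕜 i j a := ⟨_, rfl⟩
  have hNapp := clanBlock_apply (𝕜 := 𝕜) hij a
  rw [← hN] at hNapp ⊢
  have hNZ : N * Z = N := by
    rw [hN, clanBlock, Matrix.vecMulVec_mul, hZri]
  have hZN : Z * N = N := by
    rw [hN, clanBlock, Matrix.mul_vecMulVec, Matrix.mulVec_sub, Matrix.mulVec_smul, hZi, hZj, hT,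
      smul_zero, sub_zero]
  have hNN : N * N = N := by
    rw [hN, clanBlock, Matrix.vecMulVec_mul, Matrix.vecMul_vecMulVec]
    simp [hij]
  refine ⟨b, hb, ?_, Z - N, ?_, ?_, ?_⟩
  · intro r c h
    rw [hbB, Matrix.sub_apply, hBapp, hwS r c h, sub_self]
  · have : (Z - N) * (Z - N) = Z * Z - N * Z - Z * N + N * N := by noncomm_ring
    rw [this, hZZ, hNZ, hZN, hNN]; abel
  · intro r c h
    have hr : ∀ c, Z r c = (Pi.single r 1 ᵥ* Z) c := fun c => by
      rw [Matrix.single_one_vecMul]; rfl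
    have hc : ∀ r, Z r c = (Z *ᵥ Pi.single c 1) r := fun r => by
      rw [Matrix.mulVec_single_one]; rfl
    have hnot : ∀ k, k ∉ (S.erase i).erase j → k = i ∨ k = j ∨ k ∉ S := by
      intro k hk
      by_contra! h'
      exact hk (by simp [h'])
    rw [Matrix.sub_apply, hNapp]
    rcases h with h | h <;> rcases hnot _ h with rfl | rfl | h
    · rw [hr, hZri]; simp [Pi.single_apply]
    · rw [hr, hZrj]; simp [Pi.single_apply, hij.symm, hT]
    · have h1 : r ≠ i := fun h' => h (h' ▸ hiS)
      have h2 : r ≠ j := fun h' => h (h' ▸ hjS)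
      rw [hr, hZrk r h]; simp [h1, h2]
    · rw [hc, hZi]
      by_cases h1 : r = c
      · subst h1; simp [hij]
      · by_cases h2 : r = j
        · subst h2; simp [hij.symm, hT]
        · simp [h1, h2]
    · rw [hc, hZj]; simp [hij.symm]
    · have h1 : c ≠ i := fun h' => h (h' ▸ hiS)
      rw [hc, hZk c h]; simp [h1]
  · rw [hbB, add_sub_cancel, hBZ]

/-- Every idempotent is conjugate, under the Iwahori subgroup, to a normal idempotent. -/
theorem exists_conj_normal (S : Finset (Fin n)) {E : Matrix (Fin n) (Fin n) 𝕜⸨X⸩} (hE : E * E = E)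
    (hS : SupportedOn S E) :
    ∃ b ∈ iwahoriSubgroup n 𝕜, SupportedOn S ((b : Matrix (Fin n) (Fin n) 𝕜⸨X⸩) - 1) ∧
      ∃ Y : Matrix (Fin n) (Fin n) 𝕜⸨X⸩, IsNormalIdempotent Y ∧ SupportedOn S Y ∧
        E * (b : Matrix (Fin n) (Fin n) 𝕜⸨X⸩) = b * Y := by
  induction S using Finset.strongInduction generalizing E with
  | H S ih =>
  by_cases hlev : ∀ r c, LevelGE 0 r c (E r c)
  · exact exists_conj_diagonal hE hS hlev
  obtain ⟨i, j, hji, hneg, hmin⟩ : ∃ i j, E j i ≠ 0 ∧ (n : ℤ) * (E j i).order + i - j < 0 ∧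
      ∀ r c, LevelGE ((n : ℤ) * (E j i).order + i - j) r c (E r c) := by
    classical
    simp only [LevelGE] at hlev
    push Not at hlev
    obtain ⟨r, c, hrc, hlt⟩ := hlev
    obtain ⟨x, hx, hxmin⟩ := Finset.exists_min_image
      (Finset.univ.filter fun x : Fin n × Fin n => E x.1 x.2 ≠ 0)
      (fun x => (n : ℤ) * (E x.1 x.2).order + x.2 - x.1) ⟨(r, c), by simpa using hrc⟩
    refine ⟨x.2, x.1, by simpa using hx, ?_, fun r c h => hxmin (r, c) (by simpa using h)⟩
    exact (hxmin (r, c) (by simpa using hrc)).trans_lt hlt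
  have hij := ne_of_minimal_level hE hji hneg hmin
  obtain ⟨b, hb, hbS, E', hE', hE'S, hbE⟩ := exists_conj_clanBlock_add hE hS hij hji hneg hmin
  set S' := (S.erase i).erase j with hS'
  have hiS : i ∈ S := by by_contra h; exact hji (hS _ _ (.inr h))
  have hjS : j ∈ S := by by_contra h; exact hji (hS _ _ (.inl h))
  have hiS' : i ∉ S' := by simp [hS']
  have hjS' : j ∉ S' := by simp [hS']
  have hsub : S' ⊆ S := (Finset.erase_subset _ _).trans (Finset.erase_subset _ _)
  obtain ⟨b', hb', hb'S, Y, hY, hYS, hbY⟩ :=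
    ih S' (Finset.ssubset_iff_subset_ne.2 ⟨hsub, fun h => hiS' (h ▸ hiS)⟩) hE' hE'S
  set N := clanBlock 𝕜 i j (E j i).order with hN
  have hNb : N * ((b' : Matrix (Fin n) (Fin n) 𝕜⸨X⸩) - 1) = 0 := by
    ext1 r c
    rw [Matrix.mul_apply, Matrix.zero_apply]
    refine Finset.sum_eq_zero fun s _ => ?_
    rw [hN, clanBlock_apply hij]
    by_cases hs : s = i
    · rw [hb'S s c (.inl (hs ▸ hiS')), mul_zero]
    · rw [if_neg hs, zero_mul]
  have hbN : ((b' : Matrix (Fin n) (Fin n) 𝕜⸨X⸩) - 1) * N = 0 := by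
    ext1 r c
    rw [Matrix.mul_apply, Matrix.zero_apply]
    refine Finset.sum_eq_zero fun s _ => ?_
    rw [hN, clanBlock_apply hij]
    by_cases hs : s = i
    · rw [hb'S r s (.inr (hs ▸ hiS')), zero_mul]
    by_cases hs' : s = j
    · rw [hb'S r s (.inr (hs' ▸ hjS')), zero_mul]
    · simp [hs, hs']
  refine ⟨b * b', mul_mem hb hb', ?_, N + Y, hY.clanBlock_add hYS hij hiS' hjS' hneg, ?_, ?_⟩
  · intro r c h
    have h1 : ((b * b' : GL (Fin n) 𝕜⸨X⸩) : Matrix (Fin n) (Fin n) 𝕜⸨X⸩) - 1 =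
        ((b : Matrix (Fin n) (Fin n) 𝕜⸨X⸩) - 1) * ((b' : Matrix (Fin n) (Fin n) 𝕜⸨X⸩) - 1) +
          ((b : Matrix (Fin n) (Fin n) 𝕜⸨X⸩) - 1) + ((b' : Matrix (Fin n) (Fin n) 𝕜⸨X⸩) - 1) := by
      rw [Units.val_mul]; noncomm_ring
    have hb'S' : SupportedOn S ((b' : Matrix (Fin n) (Fin n) 𝕜⸨X⸩) - 1) := fun r c h =>
      hb'S r c (h.imp (mt (@hsub r)) (mt (@hsub c)))
    rw [h1, Matrix.add_apply, Matrix.add_apply, hbS r c h, hb'S' r c h, Matrix.mul_apply,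
      add_zero, add_zero]
    refine Finset.sum_eq_zero fun s _ => ?_
    rcases h with h | h
    · rw [hbS r s (.inl h), zero_mul]
    · rw [hb'S' s c (.inr h), mul_zero]
  · intro r c h
    rw [Matrix.add_apply, hYS r c (h.imp (mt (@hsub r)) (mt (@hsub c))), hN, clanBlock_apply hij,
      add_zero]
    rcases h with h | h
    · rw [if_neg (show r ≠ i from fun h' => h (h' ▸ hiS)),
        if_neg (show r ≠ j from fun h' => h (h' ▸ hjS)), ite_self]
    · rw [if_neg (show c ≠ i from fun h' => h (h' ▸ hiS))]
  · rw [Units.val_mul, ← mul_assoc, hbE, mul_assoc, mul_assoc, add_mul, mul_add _ N Y, ← hbY]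
    rw [mul_sub, mul_one, sub_eq_zero] at hNb
    rw [sub_mul, one_mul, sub_eq_zero] at hbN
    rw [hNb, hbN]

end Reduction

/-! ### The block diagonal subgroup as a centralizer -/

section BlockDiagonal

variable (p q : ℕ) (F : Type*) [Field F]

/-- The diagonal idempotent with `p` entries `1` followed by `q` entries `0`. -/
def blockIdempotent : Matrix (Fin (p + q)) (Fin (p + q)) F :=
  blockDiagonalHom p q F (1, 0)

lemma blockIdempotent_mul_self : blockIdempotent p q F * blockIdempotent p q F =
    blockIdempotent p q F := by
  rw [blockIdempotent, ← map_mul]; simp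

lemma blockIdempotent_eq_diagonal : blockIdempotent p q F =
    Matrix.diagonal fun r : Fin (p + q) => if (r : ℕ) < p then 1 else 0 := by
  ext1 r c
  induction r using Fin.addCases <;> induction c using Fin.addCases <;>
    simp [blockIdempotent, blockDiagonalHom, Matrix.diagonal_apply, Matrix.one_apply, Fin.ext_iff]
  omega

lemma rank_blockIdempotent : (blockIdempotent p q F).rank = p := by
  classical
  rw [blockIdempotent_eq_diagonal, Matrix.rank_diagonal, Fintype.card_subtype]
  simp [Fin.card_filter_val_lt]

variable {p q F}

lemma blockDiagonalHom_injective : Function.Injective (blockDiagonalHom p q F) := by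
  intro x y h
  have := (Matrix.reindex finSumFinEquiv finSumFinEquiv).injective h
  rw [Matrix.fromBlocks_inj] at this
  exact Prod.ext this.1 this.2.2.2

lemma exists_blockDiagonalHom_eq {m : Matrix (Fin (p + q)) (Fin (p + q)) F}
    (h : m * blockIdempotent p q F = blockIdempotent p q F * m) :
    ∃ x, blockDiagonalHom p q F x = m := by
  obtain ⟨m', rfl⟩ := (Matrix.reindex finSumFinEquiv finSumFinEquiv).surjective m
  obtain ⟨A, B, C, D, rfl⟩ : ∃ A B C D, m' = Matrix.fromBlocks A B C D :=
    ⟨_, _, _, _, (Matrix.fromBlocks_toBlocks m').symm⟩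
  have h' : Matrix.fromBlocks A B C D * Matrix.fromBlocks 1 0 0 0 =
      Matrix.fromBlocks 1 0 0 0 * Matrix.fromBlocks A B C D := by
    apply (Matrix.reindex finSumFinEquiv finSumFinEquiv).injective
    simpa [blockIdempotent, blockDiagonalHom] using h
  simp only [Matrix.fromBlocks_multiply, Matrix.fromBlocks_inj] at h'
  obtain ⟨-, hB, hC, -⟩ := h'
  refine ⟨(A, D), ?_⟩
  have hB : B = 0 := by simpa using hB.symm
  have hC : C = 0 := by simpa using hC
  rw [hB, hC]
  rfl

theorem mem_blockDiagonalSubgroup_iff {k : GL (Fin (p + q)) F} :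
    k ∈ blockDiagonalSubgroup p q F ↔
      (k : Matrix (Fin (p + q)) (Fin (p + q)) F) * blockIdempotent p q F =
        blockIdempotent p q F * k := by
  constructor
  · rintro ⟨x, rfl⟩
    change blockDiagonalHom p q F _ * blockDiagonalHom p q F _ =
      blockDiagonalHom p q F _ * blockDiagonalHom p q F _
    rw [← map_mul, ← map_mul]
    exact congrArg _ (Prod.ext (by simp) (by simp))
  · intro h
    obtain ⟨x, hx⟩ := exists_blockDiagonalHom_eq h
    obtain ⟨y, hy⟩ := exists_blockDiagonalHom_eq
      (m := ((k⁻¹ : GL (Fin (p + q)) F) : Matrix (Fin (p + q)) (Fin (p + q)) F)) (by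
        rw [Units.inv_mul_eq_iff_eq_mul, ← mul_assoc, h, mul_assoc, Units.mul_inv, mul_one])
    have hxy : x * y = 1 := blockDiagonalHom_injective (by rw [map_mul, hx, hy, map_one, k.mul_inv])
    have hyx : y * x = 1 := blockDiagonalHom_injective (by rw [map_mul, hx, hy, map_one, k.inv_mul])
    refine ⟨MulEquiv.prodUnits ⟨x, y, hxy, hyx⟩, Units.ext ?_⟩
    rw [← hx]
    simp

end BlockDiagonal

/-! ### Shuffles -/

section Shuffle

variable {p q : ℕ}

/-- A shuffle is determined by the set of indices that it maps to the first `p` indices. -/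
lemma shuffle_ext {σ τ : Equiv.Perm (Fin (p + q))}
    (hσ : StrictMonoOn σ.symm {r | (r : ℕ) < p}) (hσ' : StrictMonoOn σ.symm {r | p ≤ (r : ℕ)})
    (hτ : StrictMonoOn τ.symm {r | (r : ℕ) < p}) (hτ' : StrictMonoOn τ.symm {r | p ≤ (r : ℕ)})
    (h : ∀ c, (σ c : ℕ) < p ↔ (τ c : ℕ) < p) : σ = τ := by
  have top : ∀ {ρ : Equiv.Perm (Fin (p + q))}, StrictMonoOn ρ.symm {r | (r : ℕ) < p} →
      StrictMono (ρ.symm ∘ Fin.castAdd q) := fun hρ i j hij =>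
    hρ (by simp) (by simp) (Fin.lt_def.2 (by simpa using Fin.lt_def.1 hij))
  have bot : ∀ {ρ : Equiv.Perm (Fin (p + q))}, StrictMonoOn ρ.symm {r | p ≤ (r : ℕ)} →
      StrictMono (ρ.symm ∘ Fin.natAdd p) := fun hρ i j hij =>
    hρ (by simp) (by simp) (by simpa using hij)
  have rtop : ∀ ρ : Equiv.Perm (Fin (p + q)),
      Set.range (ρ.symm ∘ Fin.castAdd q) = {c | (ρ c : ℕ) < p} := by
    intro ρ
    ext c
    constructor
    · rintro ⟨i, rfl⟩; simp
    · intro hc; exact ⟨⟨ρ c, hc⟩, by simp⟩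
  have rbot : ∀ ρ : Equiv.Perm (Fin (p + q)),
      Set.range (ρ.symm ∘ Fin.natAdd p) = {c | ¬ (ρ c : ℕ) < p} := by
    intro ρ
    ext c
    constructor
    · rintro ⟨i, rfl⟩; simp
    · intro hc
      have hc : p ≤ (ρ c : ℕ) := not_lt.1 hc
      exact ⟨⟨ρ c - p, by omega⟩, by simp [hc]⟩
  have h1 : σ.symm ∘ Fin.castAdd q = τ.symm ∘ Fin.castAdd q := by
    rw [← (top hσ).range_inj (top hτ), rtop, rtop]; simp only [h]
  have h2 : σ.symm ∘ Fin.natAdd p = τ.symm ∘ Fin.natAdd p := by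
    rw [← (bot hσ').range_inj (bot hτ'), rbot, rbot]; simp only [h]
  refine Equiv.symm_bijective.injective (Equiv.ext fun r => ?_)
  induction r using Fin.addCases with
  | left i => exact congrFun h1 i
  | right i => exact congrFun h2 i

lemma exists_shuffle {T : Finset (Fin (p + q))} (hT : T.card = p) :
    ∃ σ : Equiv.Perm (Fin (p + q)), StrictMonoOn σ.symm {r | (r : ℕ) < p} ∧
      StrictMonoOn σ.symm {r | p ≤ (r : ℕ)} ∧ ∀ c, (σ c : ℕ) < p ↔ c ∈ T := by
  have hTc : Tᶜ.card = q := by rw [Finset.card_compl, hT, Fintype.card_fin]; omega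
  set σ : Equiv.Perm (Fin (p + q)) :=
    (finSumFinEquiv.symm.trans (finSumEquivOfFinset hT hTc)).symm with hσ
  have htop : ∀ i, σ.symm (Fin.castAdd q i) = T.orderEmbOfFin hT i := by simp [hσ]
  have hbot : ∀ i, σ.symm (Fin.natAdd p i) = Tᶜ.orderEmbOfFin hTc i := by simp [hσ]
  refine ⟨σ, fun r hr s hs hrs => ?_, fun r hr s hs hrs => ?_, fun c => ?_⟩
  · induction r using Fin.addCases with
    | right i => exact absurd hr (by simp)
    | left i =>
      induction s using Fin.addCases with
      | right i => exact absurd hs (by simp)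
      | left j =>
        rw [htop, htop]
        exact (T.orderEmbOfFin hT).strictMono (Fin.lt_def.2 (by simpa using Fin.lt_def.1 hrs))
  · induction r using Fin.addCases with
    | left i => exact absurd hr (by simp)
    | right i =>
      induction s using Fin.addCases with
      | left i => exact absurd hs (by simp)
      | right j => rw [hbot, hbot]; simpa using hrs
  · obtain ⟨r, rfl⟩ := σ.symm.surjective c
    rw [Equiv.apply_symm_apply]
    induction r using Fin.addCases with
    | left i => rw [htop]; simp
    | right i =>
      rw [hbot]
      simpa using Finset.mem_compl.1 (Finset.orderEmbOfFin_mem _ hTc i)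

end Shuffle

/-! ### Clan matrices and normal idempotents -/

section Clan

variable {𝕜 : Type*} [Field 𝕜] {n : ℕ}

/-- For a normal idempotent `Y` with diagonal part `D`, the unipotent matrix `1 - (Y - D)`, which
conjugates `Y` to `D`. -/
noncomputable def unipotentOf (Y : Matrix (Fin n) (Fin n) 𝕜⸨X⸩) : Matrix (Fin n) (Fin n) 𝕜⸨X⸩ :=
  1 - Y + Matrix.diagonal fun i => Y i i

namespace IsNormalIdempotent

variable {Y : Matrix (Fin n) (Fin n) 𝕜⸨X⸩}

lemma diagonal_mul (h : IsNormalIdempotent Y) :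
    Matrix.diagonal (fun i => Y i i) * Y = Matrix.diagonal fun i => Y i i := by
  ext1 r c
  rw [Matrix.diagonal_mul]
  rcases eq_or_ne r c with rfl | hrc
  · rw [Matrix.diagonal_apply_eq]
    rcases h.diag r with h0 | h0 <;> simp [h0]
  · rw [Matrix.diagonal_apply_ne _ hrc, mul_eq_zero, or_iff_not_imp_right]
    exact h.target c r hrc.symm

lemma mul_diagonal (h : IsNormalIdempotent Y) :
    Y * Matrix.diagonal (fun i => Y i i) = Y := by
  ext1 r c
  rw [Matrix.mul_diagonal]
  rcases eq_or_ne c r with rfl | hrc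
  · rcases h.diag c with h0 | h0 <;> simp [h0]
  · by_cases h0 : Y r c = 0
    · rw [h0, zero_mul]
    · rw [h.source c r hrc h0, mul_one]

lemma mul_self (h : IsNormalIdempotent Y) : Y * Y = Y := by
  have := congrArg (Y * ·) h.diagonal_mul
  simpa only [← mul_assoc, h.mul_diagonal] using this

lemma diagonal_mul_self (h : IsNormalIdempotent Y) :
    Matrix.diagonal (fun i => Y i i) * Matrix.diagonal (fun i => Y i i) =
      Matrix.diagonal fun i => Y i i := by
  have := congrArg (Matrix.diagonal (fun i => Y i i) * ·) h.mul_diagonal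
  simpa only [← mul_assoc, h.diagonal_mul] using this

lemma unipotentOf_mul (h : IsNormalIdempotent Y) :
    unipotentOf Y * Y = Matrix.diagonal fun i => Y i i := by
  rw [unipotentOf, add_mul, sub_mul, h.mul_self, h.diagonal_mul]; simp

lemma diagonal_mul_unipotentOf (h : IsNormalIdempotent Y) :
    Matrix.diagonal (fun i => Y i i) * unipotentOf Y = Matrix.diagonal fun i => Y i i := by
  rw [unipotentOf, mul_add, mul_sub, h.diagonal_mul, h.diagonal_mul_self]; simp

lemma isUnit_unipotentOf (h : IsNormalIdempotent Y) : IsUnit (unipotentOf Y) := by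
  have hsq : (Y - Matrix.diagonal fun i => Y i i) * (Y - Matrix.diagonal fun i => Y i i) = 0 := by
    rw [mul_sub, sub_mul, sub_mul, h.mul_self, h.diagonal_mul, h.mul_diagonal, h.diagonal_mul_self]
    simp
  have : unipotentOf Y = 1 - (Y - Matrix.diagonal fun i => Y i i) := by rw [unipotentOf]; abel
  rw [this]
  exact IsNilpotent.isUnit_one_sub ⟨2, by rw [pow_two, hsq]⟩

end IsNormalIdempotent

/-- The normal idempotent attached to the data of an affine clan matrix. -/
noncomputable def clanIdempotent {p q : ℕ} (𝕜 : Type*) [Field 𝕜] (σ : Equiv.Perm (Fin (p + q)))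
    (M : Finset (Fin (p + q) × Fin (p + q))) (a : Fin (p + q) → Fin (p + q) → ℤ) :
    Matrix (Fin (p + q)) (Fin (p + q)) 𝕜⸨X⸩ :=
  Matrix.of fun r c => if r = c then (if (σ c : ℕ) < p then 1 else 0) else
    if (c, r) ∈ M then -HahnSeries.single (a c r) 1 else 0

/-- The sign conditions on the exponents of a clan matrix say that the corresponding monomials have
negative level, i.e. that they do not occur in the Iwahori subgroup. -/
lemma level_neg_iff {i j : Fin n} (hij : i ≠ j) (a : ℤ) :
    (n : ℤ) * a + i - j < 0 ↔ (i < j → a ≤ 0) ∧ (j < i → a < 0) := by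
  have hi : ((i : ℕ) : ℤ) < n := by exact_mod_cast i.2
  have hj : ((j : ℕ) : ℤ) < n := by exact_mod_cast j.2
  have hi0 := Int.natCast_nonneg (i : ℕ)
  have hj0 := Int.natCast_nonneg (j : ℕ)
  rcases lt_or_gt_of_ne hij with h | h
  · have h' : ((i : ℕ) : ℤ) < (j : ℕ) := by exact_mod_cast h
    refine ⟨fun hl => ⟨fun _ => ?_, fun h'' => absurd h h''.asymm⟩, fun hl => ?_⟩
    · by_contra! h1; nlinarith
    · nlinarith [hl.1 h]
  · have h' : ((j : ℕ) : ℤ) < (i : ℕ) := by exact_mod_cast h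
    refine ⟨fun hl => ⟨fun h'' => absurd h h''.asymm, fun _ => ?_⟩, fun hl => ?_⟩
    · by_contra! h1; nlinarith
    · have : a ≤ -1 := by have := hl.2 h; omega
      nlinarith

section Datum

variable {p q : ℕ} {σ : Equiv.Perm (Fin (p + q))} {M : Finset (Fin (p + q) × Fin (p + q))}
  {a : Fin (p + q) → Fin (p + q) → ℤ}

lemma clanIdempotent_self (c : Fin (p + q)) :
    clanIdempotent 𝕜 σ M a c c = if (σ c : ℕ) < p then 1 else 0 := by
  simp [clanIdempotent]

lemma clanIdempotent_of_ne {r c : Fin (p + q)} (h : c ≠ r) : clanIdempotent 𝕜 σ M a r c =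
    if (c, r) ∈ M then -HahnSeries.single (a c r) 1 else 0 := by
  simp [clanIdempotent, h.symm]

lemma mem_of_clanIdempotent_ne_zero {r c : Fin (p + q)} (h : c ≠ r)
    (h0 : clanIdempotent 𝕜 σ M a r c ≠ 0) : (c, r) ∈ M := by
  rw [clanIdempotent_of_ne h] at h0
  by_contra hM
  exact h0 (if_neg hM)

lemma isNormalIdempotent_clanIdempotent (h : IsAffineClanDatum p q σ M a) :
    IsNormalIdempotent (clanIdempotent 𝕜 σ M a) where
  diag i := by rw [clanIdempotent_self]; split_ifs <;> simp
  off i j hij h0 := by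
    have hM := mem_of_clanIdempotent_ne_zero hij h0
    exact ⟨a i j, by rw [clanIdempotent_of_ne hij, if_pos hM],
      (level_neg_iff hij _).2 ⟨h.exponent_nonpos i j hM, h.exponent_neg i j hM⟩⟩
  row i i' j hij hij' h0 h0' := h.left_unique i j i' (mem_of_clanIdempotent_ne_zero hij h0)
    (mem_of_clanIdempotent_ne_zero hij' h0')
  col i j j' hij hij' h0 h0' := h.right_unique i j j' (mem_of_clanIdempotent_ne_zero hij h0)
    (mem_of_clanIdempotent_ne_zero hij' h0')
  source i j hij h0 := by
    rw [clanIdempotent_self, if_pos (h.top i j (mem_of_clanIdempotent_ne_zero hij h0))]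
  target i j hij h0 := by
    rw [clanIdempotent_self, if_neg (h.bot i j (mem_of_clanIdempotent_ne_zero hij h0)).not_gt]

/-- A clan matrix is the product of the permutation matrix of `σ` and of the unipotent matrix of
its normal idempotent. -/
lemma affineClanSum_eq (h : IsAffineClanDatum p q σ M a) : affineClanSum 𝕜 σ M a =
    (unipotentOf (clanIdempotent 𝕜 σ M a)).submatrix σ.symm (Equiv.refl _) := by
  ext1 r c
  obtain ⟨d, rfl⟩ := σ.surjective r
  rw [Matrix.submatrix_apply, Equiv.symm_apply_apply, Equiv.refl_apply, unipotentOf,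
    affineClanSum]
  simp only [Matrix.add_apply, Matrix.sub_apply, Matrix.of_apply, Equiv.symm_apply_apply,
    σ.injective.eq_iff]
  rcases eq_or_ne c d with rfl | hcd
  · have : (c, c) ∉ M := fun hM => h.ne c c hM rfl
    simp [this]
  · rw [Matrix.one_apply_ne hcd.symm, Matrix.diagonal_apply_ne _ hcd.symm,
      clanIdempotent_of_ne hcd, if_neg hcd.symm]
    split_ifs <;> simp

/-- Conjugation by a clan matrix maps its normal idempotent to the block idempotent. -/
lemma affineClanSum_mul_clanIdempotent (h : IsAffineClanDatum p q σ M a) :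
    affineClanSum 𝕜 σ M a * clanIdempotent 𝕜 σ M a =
      blockIdempotent p q 𝕜⸨X⸩ * affineClanSum 𝕜 σ M a := by
  have hY := isNormalIdempotent_clanIdempotent (𝕜 := 𝕜) h
  have he : blockIdempotent p q 𝕜⸨X⸩ =
      (Matrix.diagonal fun i => clanIdempotent 𝕜 σ M a i i).submatrix σ.symm σ.symm := by
    rw [blockIdempotent_eq_diagonal, Matrix.submatrix_diagonal_equiv]
    congr 1
    ext1 r
    simp [clanIdempotent_self]
  rw [he, affineClanSum_eq h, Matrix.submatrix_mul_equiv, hY.diagonal_mul_unipotentOf]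
  conv_lhs => rw [← Matrix.submatrix_id_id (clanIdempotent 𝕜 σ M a)]
  exact (Matrix.submatrix_mul_equiv _ _ σ.symm (Equiv.refl _) id).trans
    (by rw [Matrix.submatrix_id_id, hY.unipotentOf_mul]; rfl)

lemma isUnit_affineClanSum (h : IsAffineClanDatum p q σ M a) :
    IsUnit (affineClanSum 𝕜 σ M a) := by
  rw [affineClanSum_eq h, Matrix.isUnit_submatrix_equiv]
  exact (isNormalIdempotent_clanIdempotent h).isUnit_unipotentOf

/-- A normal idempotent of rank `p` arises from the data of an affine clan matrix. -/
lemma exists_isAffineClanDatum {Y : Matrix (Fin (p + q)) (Fin (p + q)) 𝕜⸨X⸩}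
    (hY : IsNormalIdempotent Y) (hrank : Y.rank = p) :
    ∃ σ M a, IsAffineClanDatum p q σ M a ∧ clanIdempotent 𝕜 σ M a = Y := by
  classical
  have hcard : (Finset.univ.filter fun i => Y i i ≠ 0).card = p := by
    refine Eq.trans ?_ hrank
    rw [← Matrix.rank_mul_eq_right_of_isUnit_det _ Y
      ((Matrix.isUnit_iff_isUnit_det _).1 hY.isUnit_unipotentOf), hY.unipotentOf_mul,
      Matrix.rank_diagonal, Fintype.card_subtype]
  obtain ⟨σ, htop, hbot, hσ⟩ := exists_shuffle hcard
  set M : Finset (Fin (p + q) × Fin (p + q)) :=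
    Finset.univ.filter fun x => x.1 ≠ x.2 ∧ Y x.2 x.1 ≠ 0 with hMdef
  have hM : ∀ i j, (i, j) ∈ M ↔ i ≠ j ∧ Y j i ≠ 0 := by simp [hMdef]
  have hσ' : ∀ c, (σ c : ℕ) < p ↔ Y c c ≠ 0 := by simp [hσ]
  have hval : ∀ i j, (i, j) ∈ M → Y j i = -HahnSeries.single (Y j i).order 1 ∧
      ((p + q : ℕ) : ℤ) * (Y j i).order + i - j < 0 := by
    intro i j hij
    obtain ⟨b, hb, hb'⟩ := hY.off i j ((hM i j).1 hij).1 ((hM i j).1 hij).2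
    have hord : (Y j i).order = b := by
      rw [hb, HahnSeries.order_neg, HahnSeries.order_single one_ne_zero]
    rw [hord]
    exact ⟨hb, hb'⟩
  refine ⟨σ, M, fun i j => (Y j i).order, ⟨htop, hbot, fun i j h => ((hM i j).1 h).1,
    fun i j k h h' => ?_, fun i j l h h' => ?_, fun i j h => ?_, fun i j h => ?_,
    fun i j h => ?_, fun i j h => ?_⟩, ?_⟩
  · rw [hM] at h h'; exact hY.col i j k h.1 h'.1 h.2 h'.2
  · rw [hM] at h h'; exact hY.row i l j h.1 h'.1 h.2 h'.2
  · rw [hM] at h; rw [hσ', hY.source i j h.1 h.2]; exact one_ne_zero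
  · rw [hM] at h; rw [← not_lt, hσ', hY.target i j h.1 h.2]; simp
  · exact ((level_neg_iff ((hM i j).1 h).1 _).1 (hval i j h).2).1
  · exact ((level_neg_iff ((hM i j).1 h).1 _).1 (hval i j h).2).2
  · ext1 r c
    rcases eq_or_ne c r with rfl | hcr
    · rw [clanIdempotent_self]
      simp only [hσ']
      rcases hY.diag c with h | h <;> simp [h]
    · rw [clanIdempotent_of_ne hcr]
      split_ifs with h
      · exact (hval c r h).1.symm
      · rw [hM] at h
        by_contra hne
        exact h ⟨hcr, fun h' => hne h'.symm⟩

end Datum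

end Clan

/-! ### The double cosets -/

theorem theorem1p2 (𝕜 : Type*) [Field 𝕜] (hchar : ringChar 𝕜 ≠ 2) (p q : ℕ) :
    Set.BijOn
      (DoubleCoset.mk (blockDiagonalSubgroup p q 𝕜⸨X⸩) (iwahoriSubgroup (p + q) 𝕜))
      {g : GL (Fin (p + q)) 𝕜⸨X⸩ | IsAffineClanMatrix p q g} Set.univ := by
  refine ⟨Set.mapsTo_univ _ _, ?_, ?_⟩
  · rintro g ⟨σ, M, a, hd, hg⟩ g' ⟨σ', M', a', hd', hg'⟩ heq
    obtain ⟨k, hk, b, hb, rfl⟩ := (DoubleCoset.eq _ _ _ _).1 heq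
    have hk' := mem_blockDiagonalSubgroup_iff.1 hk
    have h1 := affineClanSum_mul_clanIdempotent (𝕜 := 𝕜) hd
    have h2 := affineClanSum_mul_clanIdempotent (𝕜 := 𝕜) hd'
    rw [← hg] at h1
    rw [← hg'] at h2
    have hconj : clanIdempotent 𝕜 σ M a * (b : Matrix (Fin (p + q)) (Fin (p + q)) 𝕜⸨X⸩) =
        b * clanIdempotent 𝕜 σ' M' a' := by
      refine (k * g).isUnit.mul_left_cancel ?_
      simp only [Units.val_mul, mul_assoc] at h2 ⊢
      rw [h2, ← mul_assoc (g : Matrix (Fin (p + q)) (Fin (p + q)) 𝕜⸨X⸩) _ _, h1, mul_assoc,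
        ← mul_assoc, hk', mul_assoc]
    have hY := (isNormalIdempotent_clanIdempotent hd).eq_of_conj
      (isNormalIdempotent_clanIdempotent hd') hb hconj
    have hσ : σ = σ' := by
      refine shuffle_ext hd.strictMonoOn_top hd.strictMonoOn_bot hd'.strictMonoOn_top
        hd'.strictMonoOn_bot fun c => ?_
      have := congrFun (congrFun hY c) c
      rw [clanIdempotent_self, clanIdempotent_self] at this
      by_cases h : (σ c : ℕ) < p <;> by_cases h' : (σ' c : ℕ) < p <;> simp [h, h'] at this ⊢
    refine Units.ext ?_
    rw [hg, hg', affineClanSum_eq hd, affineClanSum_eq hd', hY, hσ]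
  · intro x _
    induction x using Quotient.inductionOn with
    | h g =>
    set e := blockIdempotent p q 𝕜⸨X⸩ with he
    obtain ⟨b, hb, -, Y, hY, -, hbY⟩ := exists_conj_normal (𝕜 := 𝕜) (n := p + q) Finset.univ
      (E := (g⁻¹ : GL (Fin (p + q)) 𝕜⸨X⸩) * e * g) (by
        simp only [mul_assoc, Units.mul_inv_cancel_left]
        rw [← mul_assoc e e, blockIdempotent_mul_self])
      (fun r c h => by simp at h)
    have hu : e * ((g * b : GL (Fin (p + q)) 𝕜⸨X⸩) : Matrix (Fin (p + q)) (Fin (p + q)) 𝕜⸨X⸩) =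
        (g * b : GL (Fin (p + q)) 𝕜⸨X⸩) * Y := by
      rw [Units.val_mul, mul_assoc, ← hbY]
      simp only [mul_assoc, Units.mul_inv_cancel_left]
    have hrank : Y.rank = p := by
      rw [← Matrix.rank_mul_eq_right_of_isUnit_det _ Y
        ((Matrix.isUnit_iff_isUnit_det _).1 (g * b).isUnit), ← hu,
        Matrix.rank_mul_eq_left_of_isUnit_det _ _
        ((Matrix.isUnit_iff_isUnit_det _).1 (g * b).isUnit), rank_blockIdempotent]
    obtain ⟨σ, M, a, hd, rfl⟩ := exists_isAffineClanDatum hY hrank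
    obtain ⟨c, hc⟩ := isUnit_affineClanSum (𝕜 := 𝕜) hd
    have hcY := affineClanSum_mul_clanIdempotent (𝕜 := 𝕜) hd
    rw [← hc] at hcY
    refine ⟨c, ⟨σ, M, a, hd, hc⟩, (DoubleCoset.eq _ _ _ _).2
      ⟨g * b * c⁻¹, mem_blockDiagonalSubgroup_iff.2 ?_, b⁻¹, inv_mem hb, by group⟩⟩
    rw [Units.val_mul, mul_assoc, ← mul_assoc e, hu, mul_assoc]
    congr 1
    rw [Units.inv_mul_eq_iff_eq_mul, ← mul_assoc, hcY, mul_assoc, Units.mul_inv, mul_one]
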